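/- Let $G$ be a finite group, $N$ a normal subgroup of $G$ and $F = G/N$, and suppose that the orders $\#N$ and $\#F$ are coprime. For a finite group $H$ and an $H$-module $A$ (that is, a $\mathbb{Z}H$-module), let $\hat H^n(H,A)$, $n\in\mathbb{Z}$, denote the Tate cohomology groups. Let $M$ be any $G$-module. Let $F$ act on $\hat H^n(N,M)$ through the conjugation action of $G$ (the action of $g\in G$ induced by $h\mapsto ghg^{-1}$ on $N$ and $m\mapsto gm$ on $M$; the subgroup $N$ acts trivially), and on the subgroup $M^N$ of $N$-invariants by $(gN)m=gm$. Then for every integer $n$ there is an isomorphism of abelian groups $$\hat H^n(G,M)\;\cong\;\hat H^n(N,M)^F\oplus \hat H^n(F,M^N),$$ where $\hat H^n(N,M)^F$ is the subgroup of $F$-invariant elements. -/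

import Mathlib

open CategoryTheory

noncomputable section

universe u

namespace TateConj

section Map

variable {R G H K : Type u} [CommRing R] [Group G] [Group H] [Group K]
  [Fintype G] [Fintype H] [Fintype K]

/-- Let `e : G ≃* H` be an isomorphism of finite groups, `A` a `G`-module, `B` an `H`-module and
`φ : A → B` a linear map with `φ (g a) = e(g) φ(a)`. This is the induced map of Tate complexes. It
sends a chain `a ⊗ [g₁, …, gₙ]` to `φ(a) ⊗ [e g₁, …, e gₙ]`, and a cochain `f` to
`(h₁, …, hₙ) ↦ φ (f (e⁻¹ h₁, …, e⁻¹ hₙ))`. -/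
def complexMap {A : Rep.{u} R G} {B : Rep.{u} R H} (e : G ≃* H) (φ : A.V →ₗ[R] B.V)
    (hφ : ∀ g a, φ (A.ρ g a) = B.ρ (e g) (φ a)) : tateComplex A ⟶ tateComplex B :=
  CochainComplex.ConnectData.map (tateComplexConnectData A) (tateComplexConnectData B)
    (groupHomology.chainsMap (e : G →* H)
      (Rep.ofHom (σ := B.ρ.comp (e : G →* H)) ⟨φ, fun g => LinearMap.ext fun a => hφ g a⟩))
    (groupCohomology.cochainsMap (e.symm : H →* G)
      (Rep.ofHom (ρ := A.ρ.comp (e.symm : H →* G)) ⟨φ, fun h => LinearMap.ext fun a => by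
        simpa using hφ (e.symm h) a⟩))
    (by
      ext x a y
      simp [Rep.tateNorm_eq, groupCohomology.cochainsMap_f, Representation.norm, hφ]
      exact (Equiv.sum_comp e.toEquiv fun h => B.ρ h (φ a)).symm)

lemma complexMap_congr {A : Rep.{u} R G} {B : Rep.{u} R H} {e e' : G ≃* H} {φ φ' : A.V →ₗ[R] B.V}
    (hφ : ∀ g a, φ (A.ρ g a) = B.ρ (e g) (φ a)) (hφ' : ∀ g a, φ' (A.ρ g a) = B.ρ (e' g) (φ' a))
    (he : e = e') (h : φ = φ') : complexMap e φ hφ = complexMap e' φ' hφ' := by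
  subst he h; rfl

lemma complexMap_id (A : Rep.{u} R G) :
    complexMap (A := A) (B := A) (MulEquiv.refl G) LinearMap.id (fun _ _ => rfl) = 𝟙 _ := by
  refine Eq.trans ?_ (CochainComplex.ConnectData.map_id _)
  unfold complexMap
  congr 1
  exact groupHomology.chainsMap_id

lemma complexMap_comp {A : Rep.{u} R G} {B : Rep.{u} R H} {C : Rep.{u} R K}
    (e : G ≃* H) (φ : A.V →ₗ[R] B.V) (hφ : ∀ g a, φ (A.ρ g a) = B.ρ (e g) (φ a))
    (e' : H ≃* K) (ψ : B.V →ₗ[R] C.V) (hψ : ∀ h b, ψ (B.ρ h b) = C.ρ (e' h) (ψ b)) :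
    complexMap e φ hφ ≫ complexMap e' ψ hψ =
      complexMap (e.trans e') (ψ ∘ₗ φ) (fun g a => by simp [hφ, hψ]) := by
  unfold complexMap
  rw [CochainComplex.ConnectData.map_comp_map]
  congr 1
  exact (groupHomology.chainsMap_comp _ _ _ _).symm

end Map

section Homology

variable {R : Type u} [CommRing R] {K : CochainComplex (ModuleCat.{u} R) ℤ}

lemma homologyMap_eq_id_of_d_comp (f : K ⟶ K) (i j : ℤ) (s : K.X j ⟶ K.X i)
    (h : f.f i = 𝟙 _ + K.d i j ≫ s) : HomologicalComplex.homologyMap f i = 𝟙 _ := by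
  have hc : HomologicalComplex.cyclesMap f i = 𝟙 _ := by
    rw [← cancel_mono (K.iCycles i), HomologicalComplex.cyclesMap_i, h]
    simp
  rw [← cancel_epi (K.homologyπ i), HomologicalComplex.homologyπ_naturality, hc]
  simp

lemma homologyMap_eq_id_of_comp_d (f : K ⟶ K) (i j : ℤ) (s : K.X j ⟶ K.X i)
    (h : f.f j = 𝟙 _ + s ≫ K.d i j) : HomologicalComplex.homologyMap f j = 𝟙 _ := by
  have hc : HomologicalComplex.opcyclesMap f j = 𝟙 _ := by
    rw [← cancel_epi (K.pOpcycles j), HomologicalComplex.p_opcyclesMap, h]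
    simp
  rw [← cancel_mono (K.homologyι j), HomologicalComplex.homologyι_naturality, hc]
  simp

end Homology

section LowDegree

variable {R G : Type u} [CommRing R] [Group G]

lemma d_zero_apply (A : Rep.{u} R G) (g : G) (x : (Fin 0 → G) → A.V) (y : Fin 0 → G) :
    (inhomogeneousCochains.d A 0).hom x (fun _ => g) = A.ρ g (x y) - x y := by
  rw [inhomogeneousCochains.d_hom_apply]
  simp [Subsingleton.elim _ y, sub_eq_add_neg]

lemma d_one_apply (A : Rep.{u} R G) (g : G) (x : Fin 0 → G) (a : A.V) :
    (groupHomology.inhomogeneousChains.d A 0).hom (Finsupp.single (fun _ => g⁻¹) a) =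
      Finsupp.single x (A.ρ g a) - Finsupp.single x a := by
  refine (groupHomology.inhomogeneousChains.d_single 0 _ a).trans ?_
  simp [Subsingleton.elim _ x, sub_eq_add_neg]

end LowDegree

section Inner

variable {R G : Type u} [CommRing R] [Group G] [Fintype G]

/-- The action of `g : G` on the Tate complex of a `G`-module induced by the inner automorphism
`h ↦ g h g⁻¹` of `G` and by `a ↦ g a`. -/
def innerMap (A : Rep.{u} R G) (g : G) : tateComplex A ⟶ tateComplex A :=
  complexMap (MulAut.conj g) (A.ρ g) (fun h a => by simp [← Module.End.mul_apply, ← map_mul])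

lemma map_comp_innerMap {A B : Rep.{u} R G} (f : A ⟶ B) (g : G) :
    (tateComplexFunctor R G).map f ≫ innerMap B g = innerMap A g ≫ (tateComplexFunctor R G).map f := by
  have h : (tateComplexFunctor R G).map f = complexMap (MulEquiv.refl G) f.hom.toLinearMap
    (fun (h : G) (a : A.V) => Rep.hom_comm_apply f h a) := rfl
  rw [h]
  unfold innerMap
  refine (complexMap_comp _ _ _ _ _ _).trans (Eq.trans ?_ (complexMap_comp _ _ _ _ _ _).symm)
  refine complexMap_congr _ _ (by ext; simp) ?_
  ext a
  exact (Rep.hom_comm_apply f g a).symm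

/-- The map that `innerMap A g` induces on Tate cohomology. -/
def innerCohomologyMap (A : Rep.{u} R G) (g : G) (n : ℤ) : tateCohomology A n ⟶ tateCohomology A n :=
  HomologicalComplex.homologyMap (innerMap A g) n

lemma innerCohomologyMap_zero (A : Rep.{u} R G) (g : G) : innerCohomologyMap A g 0 = 𝟙 _ := by
  let s : (groupCohomology.inhomogeneousCochains A).X 1 ⟶
      (groupCohomology.inhomogeneousCochains A).X 0 :=
    ModuleCat.ofHom (X := (Fin 1 → G) → A.V) (Y := (Fin 0 → G) → A.V)
      (LinearMap.pi fun _ => LinearMap.proj (R := R) (φ := fun _ : Fin 1 → G => A.V) fun _ => g)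
  refine homologyMap_eq_id_of_d_comp (innerMap A g) 0 1 s ?_
  refine ModuleCat.hom_ext (LinearMap.ext fun (x : (Fin 0 → G) → A.V) => funext fun y => ?_)
  have hd : ((groupCohomology.inhomogeneousCochains A).d 0 1).hom x (fun _ => g) =
      A.ρ g (x y) - x y := by
    rw [groupCohomology.inhomogeneousCochains.d_def A 0]
    exact d_zero_apply A g x y
  have hy : ∀ z, x z = x y := fun z => congrArg x (Subsingleton.elim z y)
  change A.ρ g (x _) = x y + ((groupCohomology.inhomogeneousCochains A).d 0 1).hom x (fun _ => g)
  rw [hd, hy]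
  abel

lemma innerCohomologyMap_neg_one (A : Rep.{u} R G) (g : G) : innerCohomologyMap A g (-1) = 𝟙 _ := by
  let s : (groupHomology.inhomogeneousChains A).X 0 ⟶
      (groupHomology.inhomogeneousChains A).X 1 :=
    ModuleCat.ofHom (X := (Fin 0 → G) →₀ A.V) (Y := (Fin 1 → G) →₀ A.V)
      (Finsupp.lmapDomain A.V R fun _ _ => g⁻¹)
  refine homologyMap_eq_id_of_comp_d (innerMap A g) (-2) (-1) s ?_
  refine ModuleCat.hom_ext (Finsupp.lhom_ext fun (x : Fin 0 → G) (a : A.V) => ?_)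
  have hd : ((groupHomology.inhomogeneousChains A).d 1 0).hom (Finsupp.single (fun _ => g⁻¹) a) =
      Finsupp.single x (A.ρ g a) - Finsupp.single x a := by
    rw [groupHomology.inhomogeneousChains.d_def A 0]
    exact d_one_apply A g x a
  have hs : s.hom (Finsupp.single x a) = Finsupp.single (fun _ => g⁻¹) a :=
    Finsupp.mapDomain_single
  refine (groupHomology.chainsMap_f_single _ _ 0 x a).trans ?_
  change _ = Finsupp.single x a +
    ((groupHomology.inhomogeneousChains A).d 1 0).hom (s.hom (Finsupp.single x a))
  rw [hs, hd, Subsingleton.elim (_ ∘ x) x]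
  change Finsupp.single x (A.ρ g a) = _
  abel

/-- `innerMap` on a short exact sequence of Tate complexes. -/
def innerShortComplexMap (S : ShortComplex (Rep.{u} R G)) (g : G) :
    S.map (tateComplexFunctor R G) ⟶ S.map (tateComplexFunctor R G) where
  τ₁ := innerMap S.X₁ g
  τ₂ := innerMap S.X₂ g
  τ₃ := innerMap S.X₃ g
  comm₁₂ := (map_comp_innerMap S.f g).symm
  comm₂₃ := (map_comp_innerMap S.g g).symm

lemma δ_innerCohomologyMap {S : ShortComplex (Rep.{u} R G)} (hS : S.ShortExact) (g : G) (n : ℤ) :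
    TateCohomology.δ hS n ≫ innerCohomologyMap S.X₁ g (n + 1) = innerCohomologyMap S.X₃ g n ≫ TateCohomology.δ hS n :=
  HomologicalComplex.HomologySequence.δ_naturality (innerShortComplexMap S g)
    (TateCohomology.map_tateComplexFunctor_shortExact hS)
    (TateCohomology.map_tateComplexFunctor_shortExact hS) n (n + 1) rfl

lemma exists_mono (A : Rep.{u} R G) : ∃ (B : Rep.{u} R G) (f : A ⟶ B), Mono f ∧
    ∀ n : ℕ, Limits.IsZero (tateCohomology B (n + 1 : ℕ)) := by
  let T : Rep.{u} R (⊥ : Subgroup G) := Rep.res (⊥ : Subgroup G).subtype A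
  refine ⟨Rep.coind (⊥ : Subgroup G).subtype T, Rep.resCoindToHom _ A T (𝟙 _), ?_, fun n => ?_⟩
  · rw [Rep.mono_iff_injective]
    intro x y hxy
    have := congr_fun (congrArg Subtype.val hxy) 1
    simpa using this
  · refine Limits.IsZero.of_iso ?_ ((TateCohomology.isoGroupCohomology (n + 1)).app _ ≪≫
      groupCohomology.coindIso T (n + 1))
    exact isZero_groupCohomology_succ_of_subsingleton T n

lemma exists_epi (A : Rep.{u} R G) : ∃ (B : Rep.{u} R G) (f : B ⟶ A), Epi f ∧
    ∀ n : ℕ, Limits.IsZero (tateCohomology B (-(n + 1 : ℕ) - 1)) := by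
  classical
  let T : Rep.{u} R (⊥ : Subgroup G) := Rep.res (⊥ : Subgroup G).subtype A
  refine ⟨Rep.ind (⊥ : Subgroup G).subtype T,
    (Rep.indResHomEquiv _ T A).symm (𝟙 _), ?_, fun n => ?_⟩
  · rw [Rep.epi_iff_surjective]
    intro x
    refine ⟨Representation.IndV.mk _ T.ρ 1 x, ?_⟩
    simp [Rep.indResHomEquiv]
  · refine Limits.IsZero.of_iso ?_ ((TateCohomology.isoGroupHomology _ (n + 1) (by push_cast; ring)).app _ ≪≫
      groupHomology.indIso _ T (n + 1))
    exact isZero_groupHomology_succ_of_subsingleton T n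

lemma innerCohomologyMap_nonneg (g : G) (n : ℕ) : ∀ A : Rep.{u} R G, innerCohomologyMap A g n = 𝟙 _ := by
  induction n with
  | zero => exact fun A => innerCohomologyMap_zero A g
  | succ n ih =>
    intro A
    obtain ⟨B, f, hf, hB⟩ := exists_mono A
    have hS : (ShortComplex.mk f (Limits.cokernel.π f) (by simp)).ShortExact :=
      { exact := ShortComplex.exact_cokernel f }
    have : Epi (TateCohomology.δ hS n) :=
      (TateCohomology.map_tateComplexFunctor_shortExact hS).epi_δ _ _ _ (hB n)
    rw [← cancel_epi (TateCohomology.δ hS n)]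
    have h := δ_innerCohomologyMap hS g n
    rw [ih] at h
    exact h.trans (by simp)

lemma innerCohomologyMap_neg (g : G) (n : ℕ) : ∀ A : Rep.{u} R G, innerCohomologyMap A g (-(n : ℤ) - 1) = 𝟙 _ := by
  induction n with
  | zero => exact fun A => innerCohomologyMap_neg_one A g
  | succ n ih =>
    intro A
    obtain ⟨B, f, hf, hB⟩ := exists_epi A
    have hS : (ShortComplex.mk (Limits.kernel.ι f) f (by simp)).ShortExact :=
      { exact := ShortComplex.exact_kernel f }
    have : Mono (TateCohomology.δ hS (-(n + 1 : ℕ) - 1)) :=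
      (TateCohomology.map_tateComplexFunctor_shortExact hS).mono_δ _ _ _ (hB n)
    rw [← cancel_mono (TateCohomology.δ hS (-(n + 1 : ℕ) - 1))]
    have h := δ_innerCohomologyMap hS g (-(n + 1 : ℕ) - 1)
    have e : (-(n + 1 : ℕ) - 1 : ℤ) + 1 = -n - 1 := by push_cast; ring
    have ih' : innerCohomologyMap (Limits.kernel f) g (-(n + 1 : ℕ) - 1 + 1) = 𝟙 _ := by
      rw [e]; exact ih _
    refine h.symm.trans ?_
    rw [ih']
    simp

/-- Inner automorphisms act trivially on Tate cohomology, in all degrees. -/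
lemma innerCohomologyMap_eq_id (A : Rep.{u} R G) (g : G) : ∀ n : ℤ, innerCohomologyMap A g n = 𝟙 _
  | .ofNat n => innerCohomologyMap_nonneg g n A
  | .negSucc n => by
    have := innerCohomologyMap_neg g n A
    rwa [show (-(n : ℤ) - 1) = .negSucc n by omega] at this

end Inner

section Action

variable {R G : Type u} [CommRing R] [Group G] (N : Subgroup G) [N.Normal] [Fintype N]

/-- For `N` normal in `G` and a `G`-module `M`, the action of `g : G` on the Tate complex of the
`N`-module `M`, induced by the automorphism `h ↦ g h g⁻¹` of `N` and by `m ↦ g m`. On cochains,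
`(g f)(h₁, …, hₙ) = g f(g⁻¹ h₁ g, …, g⁻¹ hₙ g)`. -/
def conjMap (M : Rep.{u} R G) (g : G) :
    tateComplex (Rep.res N.subtype M) ⟶ tateComplex (Rep.res N.subtype M) :=
  complexMap (A := Rep.res N.subtype M) (B := Rep.res N.subtype M)
    (MulAut.conjNormal g) (M.ρ g) (fun h a => by simp [← Module.End.mul_apply, ← map_mul])

/-- The conjugation action of `G` on the Tate cohomology `Ĥⁿ(N, M)`. -/
def conjRep (M : Rep.{u} R G) (n : ℤ) :
    Representation R G (tateCohomology (Rep.res N.subtype M) n) where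
  toFun g := (HomologicalComplex.homologyMap (conjMap N M g) n).hom
  map_one' := by
    have : conjMap N M 1 = 𝟙 _ := by
      rw [← complexMap_id]
      exact complexMap_congr _ _ (map_one _) (map_one _)
    rw [this, HomologicalComplex.homologyMap_id]
    rfl
  map_mul' g h := by
    have : conjMap N M (g * h) = conjMap N M h ≫ conjMap N M g := by
      refine Eq.trans ?_ (complexMap_comp _ _ _ _ _ _).symm
      exact complexMap_congr _ _ (map_mul _ _ _) (map_mul _ _ _)
    rw [this, HomologicalComplex.homologyMap_comp]
    rfl

/-- `N` acts trivially on `Ĥⁿ(N, M)`. -/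
instance conjRep_isTrivial (M : Rep.{u} R G) (n : ℤ) :
    Representation.IsTrivial ((conjRep N M n).comp N.subtype) where
  out g := by
    have h : conjMap N M g = innerMap (Rep.res N.subtype M) g :=
      complexMap_congr _ _ (by ext; simp) rfl
    change (HomologicalComplex.homologyMap (conjMap N M g) n).hom = _
    rw [h]
    exact congrArg ModuleCat.Hom.hom (innerCohomologyMap_eq_id (Rep.res N.subtype M) g n)

/-- The action of the quotient `F = G ⧸ N` on `Ĥⁿ(N, M)`: the conjugation action of `G`, which
factors through `F` because `N` acts trivially. -/
def quotientRep (M : Rep.{u} R G) (n : ℤ) :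
    Representation R (G ⧸ N) (tateCohomology (Rep.res N.subtype M) n) :=
  (conjRep N M n).ofQuotient N

end Action

end TateConj

end

noncomputable section

/-! Write a = #N and b = #F. Since Ĥⁿ(G, M) is killed by #G = ab and a, b are coprime, it is the
direct sum of its a-torsion and its b-torsion (`nonempty_equiv_natTorsion_prod`). The two summands
are identified separately, each time through maps whose kernel and cokernel are killed by the
complementary factor (`nonempty_natTorsion_equiv`).

The a-torsion is Ĥⁿ(N, M)^F (`nonempty_natTorsion_conj`). In degree 0 this is restriction M^G/N_G M
→ (M^N/N_N M)^F, with the sum over coset representatives as an inverse up to the factor b. A module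
coinduced from the trivial subgroup is acyclic for both G and N, so dimension shifting carries the
result to every degree.

The b-torsion is computed in two moves. The norm M → M^N and the inclusion M^N → M compose, on the
cohomology of G, to multiplication by a in both orders, so M may be replaced by M^N
(`nonempty_natTorsion_invariants`). For an F-module A, the b-torsion of Ĥⁿ(G, A) is Ĥⁿ(F, A)
(`nonempty_natTorsion_res`): degree 0 is explicit, and shifting over F works because an inflated
coinduced module, though not acyclic for G, has cohomology killed by a. Only degree 0 needs explicit
restriction or inflation maps. -/

/-- The subgroup of elements of `X` killed by `k`. -/
def natTorsion (X : Type*) [AddCommGroup X] (k : ℕ) : AddSubgroup X :=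
  (nsmulAddMonoidHom k : X →+ X).ker

/-! ### Torsion in abelian groups and coprime orders. -/

section Torsion

variable {X Z : Type*} [AddCommGroup X] [AddCommGroup Z] {a b : ℕ}

@[simp]
lemma mem_natTorsion {k : ℕ} {x : X} : x ∈ natTorsion X k ↔ k • x = 0 := Iff.rfl

lemma eq_zero_of_coprime_nsmul (hab : a.Coprime b) {x : X} (ha : a • x = 0) (hb : b • x = 0) :
    x = 0 := by
  rw [← AddMonoid.addOrderOf_eq_one_iff]
  exact Nat.eq_one_of_dvd_coprimes hab (addOrderOf_dvd_of_nsmul_eq_zero ha)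
    (addOrderOf_dvd_of_nsmul_eq_zero hb)

lemma exists_nsmul_mul_eq (hab : a.Coprime b) : ∃ c : ℕ, ∀ x : X, b • x = 0 → (c * a) • x = x := by
  -- For b = 0 coprimality forces a = 1; otherwise c is an inverse of a modulo b.
  rcases Nat.eq_zero_or_pos b with rfl | hb
  · refine ⟨1, fun x _ => ?_⟩
    rw [(Nat.coprime_zero_right a).1 hab, one_mul, one_nsmul]
  obtain ⟨c, hc⟩ := Nat.exists_mul_mod_eq_of_coprime 1 hab hb.ne'
  refine ⟨c, fun x hx => ?_⟩
  have h : c * a ≡ 1 [MOD b] := by rw [mul_comm]; exact hc.2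
  have := h.of_dvd (addOrderOf_dvd_of_nsmul_eq_zero hx)
  rw [nsmul_eq_nsmul_iff_modEq.2 this, one_nsmul]

/-- A homomorphism whose kernel and cokernel are killed by `a` is an isomorphism on `b`-torsion, if
`a` and `b` are coprime and the source is killed by `a * b`. -/
lemma nonempty_natTorsion_equiv (hab : a.Coprime b) (f : X →+ Z)
    (hX : ∀ x : X, (a * b) • x = 0) (hker : ∀ x, f x = 0 → a • x = 0)
    (hcoker : ∀ z, ∃ x, f x = a • z) : Nonempty (natTorsion X b ≃+ natTorsion Z b) := by
  let g : natTorsion X b →+ natTorsion Z b :=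
    (f.comp (natTorsion X b).subtype).codRestrict _ fun x => by
      rw [mem_natTorsion]
      change b • f x = 0
      rw [← map_nsmul, mem_natTorsion.1 x.2, map_zero]
  refine ⟨AddEquiv.ofBijective g ⟨?_, ?_⟩⟩
  · rw [injective_iff_map_eq_zero]
    intro x hx
    exact Subtype.ext (eq_zero_of_coprime_nsmul hab (hker _ (congrArg Subtype.val hx)) x.2)
  · rintro ⟨z, hz⟩
    obtain ⟨c, hc⟩ := exists_nsmul_mul_eq (X := Z) hab
    obtain ⟨x, hx⟩ := hcoker z
    -- Already c • x maps to z. The extra factor c * a fixes z, and it moves the preimage into the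
    -- b-torsion because a * b kills the source.
    refine ⟨⟨(c * a) • c • x, ?_⟩, Subtype.ext ?_⟩
    · rw [mem_natTorsion, smul_smul, smul_smul, show b * (c * a) * c = c * c * (a * b) by ring,
        ← smul_smul, hX, smul_zero]
    · change f ((c * a) • c • x) = z
      rw [map_nsmul, map_nsmul, hx, smul_smul c a z, hc z hz, hc z hz]

/-- Bézout 1 = au + bv gives x = (bv)x + (au)x, where a kills the first term and b the second;
coprimality makes the sum direct. -/
lemma nonempty_equiv_natTorsion_prod (hab : a.Coprime b) (hX : ∀ x : X, (a * b) • x = 0) :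
    Nonempty (X ≃+ natTorsion X a × natTorsion X b) := by
  let g : natTorsion X a × natTorsion X b →+ X :=
    (natTorsion X a).subtype.coprod (natTorsion X b).subtype
  refine ⟨(AddEquiv.ofBijective g ⟨?_, fun x => ?_⟩).symm⟩
  · rw [injective_iff_map_eq_zero]
    rintro ⟨⟨x, hx⟩, ⟨y, hy⟩⟩ h
    have h' : x + y = 0 := h
    rw [mem_natTorsion] at hx hy
    have hx' : x = -y := eq_neg_of_add_eq_zero_left h'
    have hx0 : x = 0 := eq_zero_of_coprime_nsmul hab hx (by rw [hx', smul_neg, hy, neg_zero])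
    have hy0 : y = 0 := by rwa [hx0, zero_add] at h'
    subst hx0 hy0
    rfl
  · have e : (Nat.gcd a b : ℤ) = 1 := by rw [hab]; rfl
    rw [Nat.gcd_eq_gcd_ab] at e
    have key : ∀ (k l : ℕ) (m : ℤ), k * l = a * b → k • ((l * m : ℤ) • x) = 0 := by
      intro k l m h
      rw [← natCast_zsmul, ← mul_zsmul', show ((l * m : ℤ) * (k : ℤ)) = m * ((a * b : ℕ) : ℤ) by
        rw [← h]; push_cast; ring, mul_zsmul']
      rw [natCast_zsmul, hX]
    refine ⟨(⟨(b * Nat.gcdB a b : ℤ) • x, key a b _ rfl⟩,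
      ⟨(a * Nat.gcdA a b : ℤ) • x, key b a _ (mul_comm _ _)⟩), ?_⟩
    change (b * Nat.gcdB a b : ℤ) • x + (a * Nat.gcdA a b : ℤ) • x = x
    rw [← add_zsmul, add_comm, e, one_zsmul]

/-- The equivalence on torsion induced by an equivalence. -/
def natTorsionCongr (e : X ≃+ Z) (k : ℕ) : natTorsion X k ≃+ natTorsion Z k :=
  e.addSubgroupMap (natTorsion X k) |>.trans <| AddEquiv.addSubgroupCongr <| by
    ext z
    simp only [AddSubgroup.mem_map, mem_natTorsion]
    constructor
    · rintro ⟨x, hx, rfl⟩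
      simp [← map_nsmul, hx]
    · intro hz
      exact ⟨e.symm z, by rw [← map_nsmul, hz, map_zero], by simp⟩

/-- If `X` is killed by `k`, it is its own `k`-torsion. -/
def natTorsionEquiv {k : ℕ} (h : ∀ x : X, k • x = 0) : natTorsion X k ≃+ X :=
  (AddEquiv.addSubgroupCongr ((AddSubgroup.eq_top_iff' _).2 h)).trans AddSubgroup.topEquiv

end Torsion

namespace TateConj

/-! ### Tate cohomology in degree 0 as invariants modulo norms. -/

section ZeroClass

variable {R G H : Type u} [CommRing R] [Group G] [Group H] [Fintype G] [Fintype H]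

lemma tateComplex_d_zero_one_apply (A : Rep.{u} R G) (x : (Fin 0 → G) → A.V) (y : Fin 0 → G)
    (g : G) : ((tateComplex A).d 0 1).hom x (fun _ : Fin 1 => g) = A.ρ g (x y) - x y := by
  refine Eq.trans ?_ (d_zero_apply A g x y)
  exact congrFun (congrArg (fun f => f.hom x) (groupCohomology.inhomogeneousCochains.d_def A 0)) _

lemma tateComplex_d_zero_one_eq_zero_iff (A : Rep.{u} R G) (x : (Fin 0 → G) → A.V) :
    ((tateComplex A).d 0 1).hom x = 0 ↔ x default ∈ A.ρ.invariants := by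
  constructor
  · intro h g
    have h' := tateComplex_d_zero_one_apply A x default g
    rw [h] at h'
    exact (sub_eq_zero.1 h'.symm)
  · intro h
    refine funext fun y : Fin 1 → G => ?_
    obtain ⟨g, rfl⟩ : ∃ g, y = fun _ => g := ⟨y 0, funext fun i => by rw [Subsingleton.elim i 0]⟩
    refine (tateComplex_d_zero_one_apply A x default g).trans ?_
    rw [h g, sub_self]
    rfl

/-- An invariant element as a `0`-cochain. -/
def invariantsToCochains (A : Rep.{u} R G) :
    ModuleCat.of R A.ρ.invariants ⟶ (tateComplex A).X 0 :=
  ModuleCat.ofHom (Y := (Fin 0 → G) → A.V) (LinearMap.pi fun _ => A.ρ.invariants.subtype)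

lemma invariantsToCochains_d (A : Rep.{u} R G) :
    invariantsToCochains A ≫ (tateComplex A).d 0 1 = 0 := by
  ext x : 2
  exact (tateComplex_d_zero_one_eq_zero_iff A _).2 x.2

/-- An invariant element as a `0`-cocycle. -/
def invariantsToCycles (A : Rep.{u} R G) :
    ModuleCat.of R A.ρ.invariants ⟶ (tateComplex A).cycles 0 :=
  (tateComplex A).liftCycles (invariantsToCochains A) 1 (by simp) (invariantsToCochains_d A)

lemma invariantsToCycles_i (A : Rep.{u} R G) :
    invariantsToCycles A ≫ (tateComplex A).iCycles 0 = invariantsToCochains A :=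
  (tateComplex A).liftCycles_i _ _ _ _

lemma iCycles_invariantsToCycles_apply (A : Rep.{u} R G) (x : A.ρ.invariants) :
    ((tateComplex A).iCycles 0).hom ((invariantsToCycles A).hom x) =
      fun _ : Fin 0 → G => (x : A.V) :=
  congrArg (fun f : ModuleCat.of R A.ρ.invariants ⟶ (tateComplex A).X 0 => f.hom x)
    (invariantsToCycles_i A)

lemma iCycles_injective (A : Rep.{u} R G) :
    Function.Injective ((tateComplex A).iCycles 0).hom :=
  (ModuleCat.mono_iff_injective ((tateComplex A).iCycles 0)).1 inferInstance

/-- The map sending an invariant element to its class in Tate cohomology in degree `0`. -/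
def zeroClass (A : Rep.{u} R G) : ModuleCat.of R A.ρ.invariants ⟶ tateCohomology A 0 :=
  invariantsToCycles A ≫ (tateComplex A).homologyπ 0

lemma zeroClass_surjective (A : Rep.{u} R G) : Function.Surjective (zeroClass A).hom := by
  intro z
  obtain ⟨c, rfl⟩ := (ModuleCat.epi_iff_surjective ((tateComplex A).homologyπ 0)).1 inferInstance z
  have hc : ((tateComplex A).d 0 1).hom (((tateComplex A).iCycles 0).hom c) = 0 :=
    congrArg (fun f : (tateComplex A).cycles 0 ⟶ (tateComplex A).X 1 => f.hom c)
      ((tateComplex A).iCycles_d 0 1)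
  refine ⟨⟨_, (tateComplex_d_zero_one_eq_zero_iff A _).1 hc⟩, ?_⟩
  refine congrArg ((tateComplex A).homologyπ 0).hom (iCycles_injective A ?_)
  refine (iCycles_invariantsToCycles_apply A _).trans ?_
  exact funext fun y : Fin 0 → G => congrArg
    (show (Fin 0 → G) → A.V from ((tateComplex A).iCycles 0).hom c) (Subsingleton.elim _ _)

lemma tateComplex_d_neg_one_apply (A : Rep.{u} R G) (w : (Fin 0 → G) →₀ A.V) (y : Fin 0 → G) :
    (show (Fin 0 → G) → A.V from ((tateComplex A).d (-1) 0).hom w) y = A.ρ.norm (w default) := by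
  change (A.tateNorm.hom w : (Fin 0 → G) → A.V) y = _
  rw [Rep.tateNorm_eq]
  rw [Finsupp.unique_single w]
  simp

/-- The differential from degree -1 to degree 0 is the norm. With `zeroClass_surjective` this
presents Ĥ⁰ as invariants modulo norms, the form in which all degree 0 arguments are carried out. -/
lemma zeroClass_eq_zero_iff (A : Rep.{u} R G) (x : A.ρ.invariants) :
    (zeroClass A).hom x = 0 ↔ ∃ y, A.ρ.norm y = x := by
  have hc := iCycles_invariantsToCycles_apply A x
  have hex := ShortComplex.exact_of_g_is_cokernel
    (ShortComplex.mk _ _ ((tateComplex A).toCycles_comp_homologyπ (-1) 0))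
    ((tateComplex A).homologyIsCokernel (-1) 0 (by simp))
  rw [ShortComplex.moduleCat_exact_iff] at hex
  have hd (w) : ((tateComplex A).iCycles 0).hom (((tateComplex A).toCycles (-1) 0).hom w) =
      ((tateComplex A).d (-1) 0).hom w :=
    congrArg (fun f : (tateComplex A).X (-1) ⟶ (tateComplex A).X 0 => f.hom w)
      ((tateComplex A).toCycles_i (-1) 0)
  constructor
  · intro h
    obtain ⟨w, hw⟩ := hex ((invariantsToCycles A).hom x) h
    refine ⟨(show (Fin 0 → G) →₀ A.V from w) default, ?_⟩
    rw [← tateComplex_d_neg_one_apply A w default]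
    exact congrFun ((hd w).symm.trans ((congrArg _ hw).trans hc)) _
  · rintro ⟨y, hy⟩
    have : (invariantsToCycles A).hom x = ((tateComplex A).toCycles (-1) 0).hom
        (Finsupp.single default y : (Fin 0 → G) →₀ A.V) := by
      refine iCycles_injective A (hc.trans (Eq.trans ?_ (hd _).symm))
      funext z
      refine Eq.trans ?_ (tateComplex_d_neg_one_apply A _ z).symm
      rw [Finsupp.single_eq_same, hy]
    refine (congrArg ((tateComplex A).homologyπ 0).hom this).trans ?_
    exact congrArg (fun f : (tateComplex A).X (-1) ⟶ (tateComplex A).homology 0 => f.hom _)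
      ((tateComplex A).toCycles_comp_homologyπ (-1) 0)

/-- Allowing `e` to be any isomorphism covers both morphisms of modules (`e` the identity) and the
conjugation action. -/
lemma homologyMap_complexMap_zeroClass {A : Rep.{u} R G} {B : Rep.{u} R H} (e : G ≃* H)
    (φ : A.V →ₗ[R] B.V) (hφ : ∀ g a, φ (A.ρ g a) = B.ρ (e g) (φ a)) (x : A.ρ.invariants)
    (y : B.ρ.invariants) (h : φ x = y) :
    (HomologicalComplex.homologyMap (complexMap e φ hφ) 0).hom ((zeroClass A).hom x) =
      (zeroClass B).hom y := by
  refine (congrArg (fun f : (tateComplex A).cycles 0 ⟶ (tateComplex B).homology 0 =>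
    f.hom ((invariantsToCycles A).hom x))
    (HomologicalComplex.homologyπ_naturality (complexMap e φ hφ) 0)).trans ?_
  refine congrArg ((tateComplex B).homologyπ 0).hom (iCycles_injective B ?_)
  refine Eq.trans ?_ (iCycles_invariantsToCycles_apply B y).symm
  refine (congrArg (fun f : (tateComplex A).cycles 0 ⟶ (tateComplex B).X 0 =>
    f.hom ((invariantsToCycles A).hom x))
    (HomologicalComplex.cyclesMap_i (complexMap e φ hφ) 0)).trans ?_
  refine (congrArg ((complexMap e φ hφ).f 0).hom (iCycles_invariantsToCycles_apply A x)).trans ?_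
  exact funext fun z => h

lemma map_zeroClass {A B : Rep.{u} R G} (f : A ⟶ B) (x : A.ρ.invariants) (y : B.ρ.invariants)
    (h : f.hom x = y) :
    ((tateCohomologyFunctor 0).map f).hom ((zeroClass A).hom x) = (zeroClass B).hom y :=
  homologyMap_complexMap_zeroClass (MulEquiv.refl G) f.hom.toLinearMap
    (fun g a => Rep.hom_comm_apply f g a) x y h

end ZeroClass

/-! ### Acyclicity of modules coinduced from the trivial subgroup. -/

section FunRep

variable (R G : Type u) [CommRing R] [Group G] (V : Type u) [AddCommGroup V] [Module R V]

/-- Functions `G → V` with `G` acting by right translation: the representation coinduced from the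
trivial subgroup. -/
def funRep : Rep.{u} R G :=
  Rep.of (X := G → V)
    { toFun := fun g => LinearMap.funLeft R V (· * g)
      map_one' := by ext; simp [LinearMap.funLeft]
      map_mul' := fun g h => by ext; simp [LinearMap.funLeft, mul_assoc] }

variable {R G V}

lemma funRep_ρ_apply (g x : G) (f : G → V) :
    (show G → V from (funRep R G V).ρ g f) x = f (x * g) := rfl

variable (R G V)

/-- `funRep R G V` is coinduced from the trivial subgroup. -/
def funRepIsoCoind : funRep R G V ≅
    Rep.coind (⊥ : Subgroup G).subtype (Rep.trivial.{u} R (⊥ : Subgroup G) V) :=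
  Rep.mkIso <| .mk
    { toFun := fun f : G → V => ⟨f, fun g h => by
        obtain rfl := Subsingleton.elim g 1
        simp⟩
      map_add' := fun _ _ => rfl
      map_smul' := fun _ _ => rfl
      invFun := fun f => f.1
      left_inv := fun _ => rfl
      right_inv := fun _ => rfl } fun g => rfl

variable [Fintype G]

lemma isZero_tateCohomology_funRep_pos (n : ℕ) :
    Limits.IsZero (tateCohomology (funRep R G V) (n + 1 : ℕ)) := by
  let T := Rep.trivial.{u} R (⊥ : Subgroup G) V
  refine Limits.IsZero.of_iso ?_ ((tateCohomologyFunctor _).mapIso (funRepIsoCoind R G V) ≪≫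
    (TateCohomology.isoGroupCohomology (n + 1)).app _ ≪≫ groupCohomology.coindIso T (n + 1))
  exact isZero_groupCohomology_succ_of_subsingleton T n

/-- For a finite group coinduction agrees with induction, so Shapiro's lemma in homology applies. -/
lemma isZero_tateCohomology_funRep_neg (n : ℕ) :
    Limits.IsZero (tateCohomology (funRep R G V) (-(n + 1 : ℕ) - 1)) := by
  classical
  let T := Rep.trivial.{u} R (⊥ : Subgroup G) V
  refine Limits.IsZero.of_iso ?_ ((tateCohomologyFunctor _).mapIso
    (funRepIsoCoind R G V ≪≫ (Rep.indCoindIso T).symm) ≪≫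
    (TateCohomology.isoGroupHomology _ (n + 1) (by push_cast; ring)).app _ ≪≫
    groupHomology.indIso _ T (n + 1))
  exact isZero_groupHomology_succ_of_subsingleton T n

variable {R G V} in
lemma funRep_norm_apply (f : G → V) (x : G) :
    (show G → V from (funRep R G V).ρ.norm f) x = ∑ g, f g := by
  refine (congrArg (fun f : G → V => f x) (LinearMap.sum_apply Finset.univ _ f)).trans ?_
  refine (Finset.sum_apply (M := fun _ : G => V) x _ _).trans ?_
  exact Equiv.sum_comp (Equiv.mulLeft x) f

/-- An invariant function is constant, hence the norm of the function supported at 1 with the same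
value there. -/
lemma isZero_tateCohomology_funRep_zero :
    Limits.IsZero (tateCohomology (funRep R G V) 0) := by
  classical
  have : Subsingleton (tateCohomology (funRep R G V) 0) := subsingleton_of_forall_eq 0 fun z => by
    obtain ⟨x, rfl⟩ := zeroClass_surjective _ z
    refine (zeroClass_eq_zero_iff _ x).2 ?_
    let f : G → V := x.1
    have hx (g : G) : f g = f 1 := by
      have := congrFun (show (fun y => f (y * g)) = f from x.2 g) 1
      rwa [one_mul] at this
    refine ⟨(Pi.single 1 (f 1) : G → V), funext fun g => ?_⟩
    refine (funRep_norm_apply _ g).trans ?_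
    rw [Finset.sum_pi_single']
    simpa using (hx g).symm
  exact ModuleCat.isZero_of_subsingleton _

lemma isZero_tateCohomology_funRep_neg_one :
    Limits.IsZero (tateCohomology (funRep R G V) (-1)) := by
  classical
  refine HomologicalComplex.ExactAt.isZero_homology ?_
  rw [HomologicalComplex.exactAt_iff' _ (-2) (-1) 0 (by simp) (by simp),
    ShortComplex.moduleCat_exact_iff]
  intro (w : (Fin 0 → G) →₀ (G → V)) hw
  let v : G → V := w default
  have hv : ∑ g, v g = 0 := by
    rw [← funRep_norm_apply (R := R) v 1]
    have h := tateComplex_d_neg_one_apply (funRep R G V) w default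
    exact congrFun (h.symm.trans (congrFun hw _)) 1
  let D := groupHomology.inhomogeneousChains.d (funRep R G V) 0
  have hD (y : G) (f : G → V) : D.hom (Finsupp.single (fun _ => y) f) =
      Finsupp.single default ((funRep R G V).ρ y⁻¹ f) - Finsupp.single default f := by
    have := d_one_apply (funRep R G V) y⁻¹ default f
    rwa [inv_inv] at this
  have hd : ((tateComplex (funRep R G V)).d (-2) (-1)) = D :=
    groupHomology.inhomogeneousChains.d_def _ 0
  -- With δ(w) the function supported at 1 with value w, the boundary of this chain is ∑ y, (y⁻¹ δ(v
  -- y) - δ(v y)). The translates y⁻¹ δ(v y) are supported at y and add up to v; the subtracted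
  -- terms add up to δ(∑ v y) = 0.
  refine ⟨∑ y, (Finsupp.single (fun _ => y) (Pi.single 1 (v y)) :
    (Fin 1 → G) →₀ (G → V)), ?_⟩
  refine (congrArg (fun f : (tateComplex (funRep R G V)).X (-2) ⟶
    (tateComplex (funRep R G V)).X (-1) => f.hom _) hd).trans ?_
  refine (map_sum D.hom _ _).trans ?_
  refine (Finset.sum_congr rfl fun y _ => hD y _).trans ?_
  let s : (G → V) →+ (Fin 0 → G) →₀ (G → V) := Finsupp.singleAddHom default
  have h1 : ∑ y, (Pi.single 1 (v y) : G → V) = 0 :=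
    (map_sum (AddMonoidHom.single (fun _ : G => V) 1) v _).symm.trans (by rw [hv, map_zero])
  have h2 : ∑ y, (show G → V from (funRep R G V).ρ y⁻¹ (Pi.single 1 (v y) : G → V)) = v := by
    funext x
    rw [Finset.sum_apply, Finset.sum_eq_single x]
    · exact (funRep_ρ_apply _ _ _).trans (by rw [mul_inv_cancel, Pi.single_eq_same])
    · exact fun y _ hy => (funRep_ρ_apply _ _ _).trans
        (Pi.single_eq_of_ne (fun h => hy (mul_inv_eq_one.1 h).symm) _)
    · simp
  refine (Finset.sum_sub_distrib _ _).trans ((congrArg₂ (· - ·)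
    ((map_sum s _ _).symm.trans (congrArg s h2))
    ((map_sum s _ _).symm.trans (congrArg s h1))).trans ?_)
  refine (congrArg (s v - ·) (map_zero s)).trans ((sub_zero (s v)).trans ?_)
  exact (Finsupp.unique_single w).symm

/-- `funRep R G V` has trivial Tate cohomology. -/
lemma isZero_tateCohomology_funRep : ∀ n : ℤ, Limits.IsZero (tateCohomology (funRep R G V) n)
  | .ofNat 0 => isZero_tateCohomology_funRep_zero R G V
  | .ofNat (n + 1) => isZero_tateCohomology_funRep_pos R G V n
  | .negSucc 0 => isZero_tateCohomology_funRep_neg_one R G V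
  | .negSucc (n + 1) => by
    have := isZero_tateCohomology_funRep_neg R G V n
    rwa [show (-(n + 1 : ℕ) - 1 : ℤ) = .negSucc (n + 1) by omega] at this

end FunRep

end TateConj

namespace TateConj

variable {R G : Type u} [CommRing R] [Group G] [Fintype G]

instance (n : ℤ) : (tateCohomologyFunctor (R := R) (G := G) n).Additive :=
  inferInstanceAs (tateComplexFunctor R G ⋙ HomologicalComplex.homologyFunctor _ _ n).Additive

/-! ### Traces induce zero on Tate cohomology. -/

section Trace

variable {V : Type u} [AddCommGroup V] [Module R V]

/-- The morphism `m ↦ (x ↦ φ (x m))` to a coinduced module. -/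
def toFunRep (M : Rep.{u} R G) (φ : M.V →ₗ[R] V) : M ⟶ funRep R G V :=
  Rep.ofHom (ρ := M.ρ) (σ := (funRep R G V).ρ)
    ⟨(LinearMap.pi fun x => φ ∘ₗ M.ρ x : M.V →ₗ[R] G → V), fun g => LinearMap.ext fun m =>
      funext fun x => by
        change φ (M.ρ x (M.ρ g m)) = φ (M.ρ (x * g) m)
        rw [map_mul]
        rfl⟩

/-- The morphism `f ↦ ∑ x, x⁻¹ ψ (f x)` from a coinduced module. -/
def ofFunRep (M : Rep.{u} R G) (ψ : V →ₗ[R] M.V) : funRep R G V ⟶ M :=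
  Rep.ofHom (ρ := (funRep R G V).ρ) (σ := M.ρ)
    ⟨(∑ x, M.ρ x⁻¹ ∘ₗ ψ ∘ₗ LinearMap.proj x : (G → V) →ₗ[R] M.V), fun g =>
      LinearMap.ext fun (f : G → V) => by
        have h1 (f : G → V) : (∑ x, M.ρ x⁻¹ ∘ₗ ψ ∘ₗ LinearMap.proj x : (G → V) →ₗ[R] M.V) f =
          ∑ x, M.ρ x⁻¹ (ψ (f x)) := by simp
        refine (h1 _).trans (Eq.trans ?_ (congrArg (M.ρ g) (h1 f)).symm)
        rw [map_sum, ← Equiv.sum_comp (Equiv.mulRight g⁻¹)]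
        refine Finset.sum_congr rfl fun x _ => ?_
        change M.ρ (x * g⁻¹)⁻¹ (ψ (f (x * g⁻¹ * g))) = _
        rw [inv_mul_cancel_right, mul_inv_rev, inv_inv, map_mul]
        rfl⟩

lemma ofFunRep_apply (M : Rep.{u} R G) (ψ : V →ₗ[R] M.V) (f : G → V) :
    (ofFunRep M ψ).hom f = ∑ x, M.ρ x⁻¹ (ψ (f x)) := by
  refine (?_ : _ = (∑ x, M.ρ x⁻¹ ∘ₗ ψ ∘ₗ LinearMap.proj x : (G → V) →ₗ[R] M.V) f).trans
    (by simp)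
  rfl

/-- A morphism that is the trace of a linear map induces zero on Tate cohomology. -/
lemma tateCohomology_map_eq_zero_of_trace {M M' : Rep.{u} R G} (f : M ⟶ M') (φ : M.V →ₗ[R] M'.V)
    (h : ∀ m, f.hom m = ∑ g, M'.ρ g⁻¹ (φ (M.ρ g m))) (n : ℤ) :
    (tateCohomologyFunctor n).map f = 0 := by
  -- A trace factors through an acyclic coinduced module.
  have : f = toFunRep M φ ≫ ofFunRep M' LinearMap.id := by
    ext m
    exact (h m).trans (ofFunRep_apply M' LinearMap.id _).symm
  rw [this, Functor.map_comp, (isZero_tateCohomology_funRep R G M'.V n).eq_zero_of_tgt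
    ((tateCohomologyFunctor n).map (toFunRep M φ)), Limits.zero_comp]

/-- Used with k the order of the group, with k = #N for inflated coinduced modules, and with k = 1
for restricted ones. -/
lemma nsmul_tateCohomology_eq_zero_of_trace {M : Rep.{u} R G} {k : ℕ} (φ : M.V →ₗ[R] M.V)
    (h : ∀ m : M.V, k • m = ∑ g, M.ρ g⁻¹ (φ (M.ρ g m))) (n : ℤ) (z : tateCohomology M n) :
    k • z = 0 := by
  have h0 := tateCohomology_map_eq_zero_of_trace (k • 𝟙 M) φ (fun m => (h m).symm ▸ rfl) n
  rw [Functor.map_nsmul, CategoryTheory.Functor.map_id] at h0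
  exact congrArg (fun f : tateCohomology M n ⟶ tateCohomology M n => f.hom z) h0

/-- Tate cohomology is killed by the order of the group. -/
lemma card_nsmul_tateCohomology (M : Rep.{u} R G) (n : ℤ) (z : tateCohomology M n) :
    Nat.card G • z = 0 :=
  nsmul_tateCohomology_eq_zero_of_trace LinearMap.id (fun m => by simp) n z

end Trace

/-! ### Dimension shifting. -/

section Shift

omit [Fintype G] in
lemma toFunRep_id_injective (M : Rep.{u} R G) :
    Function.Injective (toFunRep M LinearMap.id).hom := fun x y h => by
  have : M.ρ 1 x = M.ρ 1 y := congrFun h 1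
  simpa using this

lemma ofFunRep_id_surjective (M : Rep.{u} R G) :
    Function.Surjective (ofFunRep M LinearMap.id).hom := fun x => by
  classical
  refine ⟨(Pi.single 1 x : G → M.V), (ofFunRep_apply _ _ _).trans ?_⟩
  rw [Finset.sum_eq_single 1 (fun y _ hy => by simp [hy]) (by simp)]
  simp

/-- The exact sequence `0 ⟶ M ⟶ funRep R G M ⟶ C ⟶ 0`. -/
def coindSequence (M : Rep.{u} R G) : ShortComplex (Rep.{u} R G) :=
  ShortComplex.mk (toFunRep M LinearMap.id) (Limits.cokernel.π (toFunRep M LinearMap.id))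
    (Limits.cokernel.condition _)

/-- The exact sequence `0 ⟶ K ⟶ funRep R G M ⟶ M ⟶ 0`. -/
def indSequence (M : Rep.{u} R G) : ShortComplex (Rep.{u} R G) :=
  ShortComplex.mk (Limits.kernel.ι (ofFunRep M LinearMap.id)) (ofFunRep M LinearMap.id)
    (Limits.kernel.condition _)

omit [Fintype G] in
lemma coindSequence_shortExact (M : Rep.{u} R G) : (coindSequence M).ShortExact :=
  have : Mono (toFunRep M LinearMap.id) := (Rep.mono_iff_injective _).2 (toFunRep_id_injective M)
  { exact := ShortComplex.exact_cokernel (toFunRep M LinearMap.id)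
    mono_f := this
    epi_g := inferInstanceAs (Epi (Limits.cokernel.π (toFunRep M LinearMap.id))) }

lemma indSequence_shortExact (M : Rep.{u} R G) : (indSequence M).ShortExact :=
  have : Epi (ofFunRep M LinearMap.id) := (Rep.epi_iff_surjective _).2 (ofFunRep_id_surjective M)
  { exact := ShortComplex.exact_kernel (ofFunRep M LinearMap.id)
    mono_f := inferInstanceAs (Mono (Limits.kernel.ι (ofFunRep M LinearMap.id)))
    epi_g := this }

lemma isIso_δ {S : ShortComplex (Rep.{u} R G)} (hS : S.ShortExact) (n : ℤ)
    (h : ∀ n, Limits.IsZero (tateCohomology S.X₂ n)) : IsIso (TateCohomology.δ hS n) :=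
  (TateCohomology.map_tateComplexFunctor_shortExact hS).isIso_δ n (n + 1) rfl (h n) (h (n + 1))

/-- Dimension shifting: to prove a property of Tate cohomology in all degrees, prove it in degree
`0` and transport it along the connecting maps of `coindSequence` and `indSequence`. -/
lemma dimensionShift {P : ℤ → Rep.{u} R G → Prop} (zero : ∀ M, P 0 M)
    (up : ∀ n M, P n (coindSequence M).X₃ → P (n + 1) M)
    (down : ∀ n M, P (n + 1) (indSequence M).X₁ → P n M) (n : ℤ) : ∀ M, P n M := by
  induction n using Int.induction_on with
  | zero => exact zero
  | succ n ih => exact fun M => up n M (ih _)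
  | pred n ih => exact fun M => down _ M (by rw [sub_add_cancel]; exact ih _)

end Shift

end TateConj

/-! ### Summation over cosets. -/

lemma bijective_quotient_out_mul {G : Type*} [Group G] (N : Subgroup G) :
    Function.Bijective fun p : (G ⧸ N) × N => p.1.out * (p.2 : G) := by
  constructor
  · rintro ⟨q, h⟩ ⟨q', h'⟩ e
    have hq : q = q' := by
      have := congrArg (QuotientGroup.mk (s := N)) e
      simpa using this
    subst hq
    simpa using e
  · intro g
    refine ⟨⟨g, (g : G ⧸ N).out⁻¹ * g, ?_⟩, by simp⟩
    rw [← QuotientGroup.eq]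
    simp

lemma sum_eq_sum_quotient {G X : Type*} [Group G] [AddCommMonoid X] (N : Subgroup G) [Fintype G]
    [Fintype N] [Fintype (G ⧸ N)] (F : G → X) :
    ∑ g, F g = ∑ q : G ⧸ N, ∑ h : N, F (q.out * h) := by
  rw [← Fintype.sum_prod_type' (fun (q : G ⧸ N) (h : N) => F (q.out * h))]
  exact ((bijective_quotient_out_mul N).sum_comp F).symm

lemma sum_quotient_mk {G X : Type*} [Group G] [AddCommMonoid X] (N : Subgroup G) [Fintype G]
    [Fintype N] [Fintype (G ⧸ N)] (F : G ⧸ N → X) :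
    ∑ g : G, F g = Nat.card N • ∑ q, F q := by
  rw [sum_eq_sum_quotient N, Finset.smul_sum]
  simp

/-! ### The norm of N, and passage from M to its N-invariants. -/

namespace TateConj

variable {R G : Type u} [CommRing R] [Group G] [Fintype G] (N : Subgroup G) [N.Normal] [Fintype N]

section Norm

omit [Fintype G]

/-- The norm element of a normal subgroup `N`, acting as an endomorphism of a `G`-module. -/
def subgroupNorm (M : Rep.{u} R G) : M ⟶ M :=
  Rep.ofHom (ρ := M.ρ) (σ := M.ρ) ⟨∑ h : N, M.ρ h, fun g => by
    ext m
    simp only [LinearMap.comp_apply, LinearMap.sum_apply, map_sum]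
    rw [← Equiv.sum_comp (MulAut.conjNormal (H := N) g).toEquiv]
    simp [← Module.End.mul_apply, ← map_mul]⟩

lemma subgroupNorm_apply (M : Rep.{u} R G) (m : M.V) :
    (subgroupNorm N M).hom m = ∑ h : N, M.ρ h m :=
  LinearMap.sum_apply _ _ _

lemma subgroupNorm_naturality {A B : Rep.{u} R G} (f : A ⟶ B) :
    subgroupNorm N A ≫ f = f ≫ subgroupNorm N B := by
  ext m
  change f.hom ((subgroupNorm N A).hom m) = (subgroupNorm N B).hom (f.hom m)
  simp only [subgroupNorm_apply, map_sum, Rep.hom_comm_apply]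

/-- The norm `M ⟶ M^N`. -/
def normToInvariants (M : Rep.{u} R G) :
    M ⟶ Rep.res (QuotientGroup.mk' N) (M.quotientToInvariants N) :=
  Rep.ofHom (ρ := M.ρ)
    (σ := (M.ρ.quotientToInvariants N).comp (QuotientGroup.mk' N))
    ⟨(subgroupNorm N M).hom.toLinearMap.codRestrict _ fun m h => by
      change M.ρ h ((subgroupNorm N M).hom m) = (subgroupNorm N M).hom m
      rw [subgroupNorm_apply, map_sum]
      conv_rhs => rw [← Equiv.sum_comp (Equiv.mulLeft h)]
      simp, fun g => LinearMap.ext fun m => Subtype.ext (Rep.hom_comm_apply (subgroupNorm N M) g m)⟩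

/-- The inclusion `M^N ⟶ M`. -/
def ofInvariants (M : Rep.{u} R G) :
    Rep.res (QuotientGroup.mk' N) (M.quotientToInvariants N) ⟶ M :=
  Rep.ofHom (M.ρ.quotientToInvariants_lift N)

lemma normToInvariants_comp (M : Rep.{u} R G) :
    normToInvariants N M ≫ ofInvariants N M = subgroupNorm N M := rfl

lemma ofInvariants_comp (M : Rep.{u} R G) :
    ofInvariants N M ≫ normToInvariants N M = Nat.card N • 𝟙 _ := by
  ext m
  refine (subgroupNorm_apply N M m.1).trans ?_
  refine (Finset.sum_congr rfl fun h _ => m.2 h).trans ?_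
  rw [Finset.sum_const, Finset.card_univ, ← Nat.card_eq_fintype_card]
  rfl

end Norm

/-- The norm element of a normal subgroup acts on Tate cohomology as multiplication by the order of
the subgroup. -/
lemma map_subgroupNorm (n : ℤ) : ∀ M : Rep.{u} R G,
    (tateCohomologyFunctor n).map (subgroupNorm N M) = Nat.card N • 𝟙 _ := by
  -- Being natural in the module, the norm of N commutes with connecting maps. This reduces the
  -- claim to degree 0, where N fixes the invariants of G.
  have hδ {S : ShortComplex (Rep.{u} R G)} (hS : S.ShortExact) (n : ℤ) :
      TateCohomology.δ hS n ≫ (tateCohomologyFunctor (n + 1)).map (subgroupNorm N S.X₁) =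
        (tateCohomologyFunctor n).map (subgroupNorm N S.X₃) ≫ TateCohomology.δ hS n :=
    TateCohomology.δ_naturality hS hS
      ⟨subgroupNorm N S.X₁, subgroupNorm N S.X₂, subgroupNorm N S.X₃,
        subgroupNorm_naturality N _, subgroupNorm_naturality N _⟩ n
  have hup {S : ShortComplex (Rep.{u} R G)} (hS : S.ShortExact) (n : ℤ)
      [IsIso (TateCohomology.δ hS n)]
      (h : (tateCohomologyFunctor n).map (subgroupNorm N S.X₃) = Nat.card N • 𝟙 _) :
      (tateCohomologyFunctor (n + 1)).map (subgroupNorm N S.X₁) = Nat.card N • 𝟙 _ := by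
    rw [← cancel_epi (TateCohomology.δ hS n), hδ, h, Preadditive.nsmul_comp,
      Preadditive.comp_nsmul, Category.id_comp, Category.comp_id]
  have hdown {S : ShortComplex (Rep.{u} R G)} (hS : S.ShortExact) (n : ℤ)
      [IsIso (TateCohomology.δ hS n)]
      (h : (tateCohomologyFunctor (n + 1)).map (subgroupNorm N S.X₁) = Nat.card N • 𝟙 _) :
      (tateCohomologyFunctor n).map (subgroupNorm N S.X₃) = Nat.card N • 𝟙 _ := by
    rw [← cancel_mono (TateCohomology.δ hS n), ← hδ, h, Preadditive.nsmul_comp,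
      Preadditive.comp_nsmul, Category.id_comp, Category.comp_id]
  refine dimensionShift (P := fun n (M : Rep.{u} R G) =>
    (tateCohomologyFunctor n).map (subgroupNorm N M) = Nat.card N • 𝟙 _)
    (fun M => ?_) (fun n M ih => ?_) (fun n M ih => ?_) n
  · refine ModuleCat.hom_ext (LinearMap.ext fun z => ?_)
    obtain ⟨x, rfl⟩ := zeroClass_surjective M z
    refine (map_zeroClass (subgroupNorm N M) x (Nat.card N • x) ?_).trans ?_
    · rw [subgroupNorm_apply]
      refine (Finset.sum_congr rfl fun (h : N) _ => x.2 (h : G)).trans ?_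
      rw [Finset.sum_const, Finset.card_univ, ← Nat.card_eq_fintype_card]
      rfl
    · exact map_nsmul (zeroClass M).hom _ _
  · have := isIso_δ (coindSequence_shortExact M) n (isZero_tateCohomology_funRep R G M.V)
    exact hup (coindSequence_shortExact M) n ih
  · have := isIso_δ (indSequence_shortExact M) n (isZero_tateCohomology_funRep R G M.V)
    exact hdown (indSequence_shortExact M) n ih

omit [N.Normal] [Fintype N] in
lemma card_mul_card_nsmul_tateCohomology (M : Rep.{u} R G) (n : ℤ) (z : tateCohomology M n) :
    (Nat.card N * Nat.card (G ⧸ N)) • z = 0 := by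
  rw [mul_comm, ← Subgroup.card_eq_card_quotient_mul_card_subgroup]
  exact card_nsmul_tateCohomology M n z

/-- Both composites of norm and inclusion are multiplication by #N: one by `map_subgroupNorm`, the
other because N acts trivially on M^N. -/
lemma nonempty_natTorsion_invariants (hcop : (Nat.card N).Coprime (Nat.card (G ⧸ N)))
    (M : Rep.{u} R G) (n : ℤ) :
    Nonempty (natTorsion (tateCohomology M n) (Nat.card (G ⧸ N)) ≃+
      natTorsion (tateCohomology (Rep.res (QuotientGroup.mk' N) (M.quotientToInvariants N)) n)
        (Nat.card (G ⧸ N))) := by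
  have h1 : (tateCohomologyFunctor n).map (normToInvariants N M) ≫
      (tateCohomologyFunctor n).map (ofInvariants N M) = Nat.card N • 𝟙 _ := by
    rw [← Functor.map_comp, normToInvariants_comp, map_subgroupNorm]
  have h2 : (tateCohomologyFunctor n).map (ofInvariants N M) ≫
      (tateCohomologyFunctor n).map (normToInvariants N M) = Nat.card N • 𝟙 _ := by
    rw [← Functor.map_comp, ofInvariants_comp, Functor.map_nsmul, CategoryTheory.Functor.map_id]
  refine nonempty_natTorsion_equiv hcop
    ((tateCohomologyFunctor n).map (normToInvariants N M)).hom.toAddMonoidHom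
    (card_mul_card_nsmul_tateCohomology N M n) (fun x hx => ?_) (fun z => ?_)
  · have := congrArg (fun f : tateCohomology M n ⟶ tateCohomology M n => f.hom x) h1
    refine this.symm.trans ?_
    exact (congrArg ((tateCohomologyFunctor n).map (ofInvariants N M)).hom hx).trans (map_zero _)
  · exact ⟨((tateCohomologyFunctor n).map (ofInvariants N M)).hom z,
      congrArg (fun f : tateCohomology _ n ⟶ tateCohomology _ n => f.hom z) h2⟩

end TateConj

/-! ### Cohomology of modules inflated from the quotient. -/

namespace TateConj

variable {R G : Type u} [CommRing R] [Group G] [Fintype G]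

/-- Dimension shifting away from a: by the long exact sequence, the kernel and cokernel of the
connecting map are killed by a as soon as the cohomology of the middle term is. -/
lemma nonempty_natTorsion_δ {a b : ℕ} (hab : a.Coprime b) {S : ShortComplex (Rep.{u} R G)}
    (hS : S.ShortExact) (n : ℤ) (hX : ∀ z : tateCohomology S.X₃ n, (a * b) • z = 0)
    (h : ∀ (n : ℤ) (z : tateCohomology S.X₂ n), a • z = 0) :
    Nonempty (natTorsion (tateCohomology S.X₃ n) b ≃+
      natTorsion (tateCohomology S.X₁ (n + 1)) b) := by
  have h₃ := (ShortComplex.moduleCat_exact_iff _).1 (TateCohomology.exact₃ hS n)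
  have h₁ := (ShortComplex.moduleCat_exact_iff _).1 (TateCohomology.exact₁ hS n)
  refine nonempty_natTorsion_equiv hab (TateCohomology.δ hS n).hom.toAddMonoidHom hX
    (fun x hx => ?_) (fun z => ?_)
  · obtain ⟨y, rfl⟩ := h₃ x hx
    refine (map_nsmul ((tateCohomologyFunctor n).map S.g).hom a y).symm.trans ?_
    exact (congrArg _ (h n y)).trans (map_zero _)
  · refine h₁ (a • z) ?_
    exact (map_nsmul ((tateCohomologyFunctor (n + 1)).map S.f).hom a z).trans (h _ _)

/-- The connecting isomorphism when the middle term of the sequence is acyclic. -/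
def δAddEquiv {S : ShortComplex (Rep.{u} R G)} (hS : S.ShortExact) (n : ℤ)
    (h : ∀ n, Limits.IsZero (tateCohomology S.X₂ n)) :
    tateCohomology S.X₃ n ≃+ tateCohomology S.X₁ (n + 1) :=
  have := isIso_δ hS n h
  (asIso (TateCohomology.δ hS n)).toLinearEquiv.toAddEquiv

/-- Homomorphisms out of degree `0` Tate cohomology. -/
lemma exists_zeroClass_lift (M : Rep.{u} R G) {Z : Type*} [AddCommGroup Z]
    (r : M.ρ.invariants →+ Z) (hr : ∀ (x : M.ρ.invariants) (y : M.V), M.ρ.norm y = x → r x = 0) :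
    ∃ f : tateCohomology M 0 →+ Z, ∀ x, f ((zeroClass M).hom x) = r x := by
  let π : M.ρ.invariants →+ tateCohomology M 0 := (zeroClass M).hom.toAddMonoidHom
  have hπ : Function.Surjective π := zeroClass_surjective M
  refine ⟨π.liftOfSurjective hπ ⟨r, fun x hx => ?_⟩, fun x => ?_⟩
  · obtain ⟨y, hy⟩ := (zeroClass_eq_zero_iff M x).1 hx
    exact hr x y hy
  · exact AddMonoidHom.liftOfRightInverse_comp_apply π _ _ ⟨r, _⟩ x

section Inflation

variable (N : Subgroup G) [N.Normal] [Fintype N] [Fintype (G ⧸ N)]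

lemma norm_res_mk (A : Rep.{u} R (G ⧸ N)) (y : A.V) :
    (Rep.res (QuotientGroup.mk' N) A).ρ.norm y = Nat.card N • A.ρ.norm y := by
  simp only [Representation.norm, LinearMap.sum_apply]
  exact sum_quotient_mk N fun q => A.ρ q y

/-- G and F have the same invariants on A, but the norm of G is #N times that of F. So the identity
on invariants descends to a map from Ĥ⁰(G, A) onto Ĥ⁰(F, A), with kernel killed by #N. -/
lemma nonempty_natTorsion_res_zero (hcop : (Nat.card N).Coprime (Nat.card (G ⧸ N)))
    (A : Rep.{u} R (G ⧸ N)) :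
    Nonempty (natTorsion (tateCohomology (Rep.res (QuotientGroup.mk' N) A) 0)
      (Nat.card (G ⧸ N)) ≃+ tateCohomology A 0) := by
  let B := Rep.res (QuotientGroup.mk' N) A
  let ι : B.ρ.invariants →+ A.ρ.invariants :=
    B.ρ.invariants.toAddSubgroup.subtype.codRestrict A.ρ.invariants fun x q => by
      obtain ⟨g, rfl⟩ := QuotientGroup.mk_surjective q
      exact x.2 g
  obtain ⟨f, hf⟩ := exists_zeroClass_lift B ((zeroClass A).hom.toAddMonoidHom.comp ι)
    fun x y hy => (zeroClass_eq_zero_iff A (ι x)).2 ⟨Nat.card N • y, by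
      rw [map_nsmul, ← norm_res_mk]
      exact hy⟩
  refine (nonempty_natTorsion_equiv hcop f
    (card_mul_card_nsmul_tateCohomology N _ 0) (fun z hz => ?_) (fun z => ?_)).map
    fun e => e.trans (natTorsionEquiv (card_nsmul_tateCohomology A 0))
  · obtain ⟨x, rfl⟩ := zeroClass_surjective B z
    rw [hf] at hz
    obtain ⟨y, hy⟩ := (zeroClass_eq_zero_iff A (ι x)).1 hz
    refine (map_nsmul (zeroClass B).hom _ x).symm.trans ((zeroClass_eq_zero_iff B _).2 ⟨y, ?_⟩)
    exact (norm_res_mk N A y).trans (congrArg (Nat.card N • ·) hy)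
  · obtain ⟨x, rfl⟩ := zeroClass_surjective A z
    let x' : B.ρ.invariants := ⟨x.1, fun g => x.2 g⟩
    refine ⟨(zeroClass B).hom (Nat.card N • x'), ?_⟩
    rw [hf, map_nsmul]
    rfl

/-- The inflation of a coinduced module has Tate cohomology killed by the order of the kernel. -/
lemma card_nsmul_tateCohomology_res_funRep (V : Type u) [AddCommGroup V] [Module R V] (n : ℤ)
    (z : tateCohomology (Rep.res (QuotientGroup.mk' N) (funRep R (G ⧸ N) V)) n) :
    Nat.card N • z = 0 := by
  classical
  -- The map φ keeps only the value at the identity coset. Its conjugate by g keeps only the value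
  -- at the coset of g, and each coset arises from #N elements g.
  refine nsmul_tateCohomology_eq_zero_of_trace
    (LinearMap.single R (fun _ : G ⧸ N => V) 1 ∘ₗ LinearMap.proj 1) (fun (f : G ⧸ N → V) => ?_) n z
  funext x
  refine Eq.trans ?_ (Finset.sum_apply (M := fun _ : G ⧸ N => V) x _ _).symm
  have h (g : G) : (Pi.single 1 (f g) : G ⧸ N → V) (x * (g : G ⧸ N)⁻¹) =
      if x = g then f x else 0 := by
    by_cases h : x = g
    · rw [if_pos h, ← h, mul_inv_cancel, Pi.single_eq_same]
    · rw [if_neg h, Pi.single_eq_of_ne (mt mul_inv_eq_one.1 h)]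
  refine Eq.trans ?_ (Finset.sum_congr rfl fun g _ => (h g).symm.trans ?_)
  · rw [sum_quotient_mk N fun q => if x = q then f x else 0, Finset.sum_ite_eq,
      if_pos (Finset.mem_univ x)]
    rfl
  · refine Eq.trans ?_ (funRep_ρ_apply (R := R) (g : G ⧸ N)⁻¹ x _).symm
    refine congrFun (congrArg (Pi.single 1) ?_) _
    exact congrArg f (one_mul _).symm

/-- If the order of `N` is coprime to its index, inflation identifies the cohomology of `G ⧸ N` with
the part of the cohomology of `G` that is killed by the index. -/
lemma nonempty_natTorsion_res (hcop : (Nat.card N).Coprime (Nat.card (G ⧸ N))) (n : ℤ) :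
    ∀ A : Rep.{u} R (G ⧸ N),
    Nonempty (natTorsion (tateCohomology (Rep.res (QuotientGroup.mk' N) A) n)
      (Nat.card (G ⧸ N)) ≃+ tateCohomology A n) := by
  -- The shifting sequences are those of F-modules, inflated to G.
  have hδ {S : ShortComplex (Rep.{u} R (G ⧸ N))} (hS : S.ShortExact) (n : ℤ)
      (h : ∀ (n : ℤ) (z : tateCohomology (Rep.res (QuotientGroup.mk' N) S.X₂) n),
        Nat.card N • z = 0) :=
    nonempty_natTorsion_δ hcop ((Rep.shortExact_res (QuotientGroup.mk' N)).2 hS) n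
      (card_mul_card_nsmul_tateCohomology N _ n) h
  refine dimensionShift (P := fun n (A : Rep.{u} R (G ⧸ N)) =>
    Nonempty (natTorsion (tateCohomology (Rep.res (QuotientGroup.mk' N) A) n)
      (Nat.card (G ⧸ N)) ≃+ tateCohomology A n))
    (nonempty_natTorsion_res_zero N hcop) (fun n A ⟨e⟩ => ?_) (fun n A ⟨e⟩ => ?_) n
  · obtain ⟨e'⟩ := hδ (coindSequence_shortExact A) n (card_nsmul_tateCohomology_res_funRep N A.V)
    exact ⟨e'.symm.trans (e.trans (δAddEquiv (coindSequence_shortExact A) n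
      (isZero_tateCohomology_funRep R _ A.V)))⟩
  · obtain ⟨e'⟩ := hδ (indSequence_shortExact A) n (card_nsmul_tateCohomology_res_funRep N A.V)
    exact ⟨e'.trans (e.trans (δAddEquiv (indSequence_shortExact A) n
      (isZero_tateCohomology_funRep R _ A.V)).symm)⟩

end Inflation

end TateConj

/-! ### Restriction to N and the conjugation action. -/

namespace TateConj

variable {R G : Type u} [CommRing R] [Group G] (N : Subgroup G) [N.Normal] [Fintype N]

section Conj

lemma map_comp_conjMap {A B : Rep.{u} R G} (f : A ⟶ B) (g : G) :
    (tateComplexFunctor R N).map ((Rep.resFunctor N.subtype).map f) ≫ conjMap N B g =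
      conjMap N A g ≫ (tateComplexFunctor R N).map ((Rep.resFunctor N.subtype).map f) := by
  have h : (tateComplexFunctor R N).map ((Rep.resFunctor N.subtype).map f) =
    complexMap (A := Rep.res N.subtype A) (B := Rep.res N.subtype B)
      (MulEquiv.refl N) f.hom.toLinearMap
      (fun (h : N) (a : A.V) => Rep.hom_comm_apply f (h : G) a) := rfl
  rw [h]
  unfold conjMap
  refine (complexMap_comp _ _ _ _ _ _).trans (Eq.trans ?_ (complexMap_comp _ _ _ _ _ _).symm)
  refine complexMap_congr _ _ (by ext; simp) ?_
  ext a
  exact (Rep.hom_comm_apply f g a).symm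

/-- The conjugation action on a short exact sequence of Tate complexes. -/
def conjShortComplexMap (S : ShortComplex (Rep.{u} R G)) (g : G) :
    (S.map (Rep.resFunctor N.subtype)).map (tateComplexFunctor R N) ⟶
      (S.map (Rep.resFunctor N.subtype)).map (tateComplexFunctor R N) where
  τ₁ := conjMap N S.X₁ g
  τ₂ := conjMap N S.X₂ g
  τ₃ := conjMap N S.X₃ g
  comm₁₂ := (map_comp_conjMap N S.f g).symm
  comm₂₃ := (map_comp_conjMap N S.g g).symm

/-- The map m ↦ g m is only semilinear over N, so naturality is applied to the short exact sequence
of Tate complexes, on which g does act. -/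
lemma δ_conjRep {S : ShortComplex (Rep.{u} R G)}
    (hS : (S.map (Rep.resFunctor N.subtype)).ShortExact) (n : ℤ) (g : G)
    (z : tateCohomology (Rep.res N.subtype S.X₃) n) :
    conjRep N S.X₁ (n + 1) g ((TateCohomology.δ hS n).hom z) =
      (TateCohomology.δ hS n).hom (conjRep N S.X₃ n g z) :=
  congrArg (fun f : tateCohomology (Rep.res N.subtype S.X₃) n ⟶
      tateCohomology (Rep.res N.subtype S.X₁) (n + 1) => f.hom z)
    (HomologicalComplex.HomologySequence.δ_naturality (conjShortComplexMap N S g)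
      (TateCohomology.map_tateComplexFunctor_shortExact hS)
      (TateCohomology.map_tateComplexFunctor_shortExact hS) n (n + 1) rfl)

lemma mem_invariants_quotientRep (M : Rep.{u} R G) (n : ℤ)
    (z : tateCohomology (Rep.res N.subtype M) n) :
    z ∈ (quotientRep N M n).invariants ↔ ∀ g, conjRep N M n g z = z :=
  ⟨fun h g => h (g : G ⧸ N), fun h q => by
    obtain ⟨g, rfl⟩ := QuotientGroup.mk_surjective q
    exact h g⟩

/-- The connecting isomorphism on invariants of the cohomology of a normal subgroup. -/
def invariantsδAddEquiv {S : ShortComplex (Rep.{u} R G)} (hS : S.ShortExact) (n : ℤ)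
    (h : ∀ n, Limits.IsZero (tateCohomology (Rep.res N.subtype S.X₂) n)) :
    (quotientRep N S.X₃ n).invariants ≃+ (quotientRep N S.X₁ (n + 1)).invariants :=
  let e : tateCohomology (Rep.res N.subtype S.X₃) n ≃+
      tateCohomology (Rep.res N.subtype S.X₁) (n + 1) :=
    δAddEquiv ((Rep.shortExact_res N.subtype).2 hS) n h
  have he (g : G) (z : tateCohomology (Rep.res N.subtype S.X₃) n) :
      conjRep N S.X₁ (n + 1) g (e z) = e (conjRep N S.X₃ n g z) :=
    δ_conjRep N ((Rep.shortExact_res N.subtype).2 hS) n g z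
  { toFun := fun z => ⟨e z.1, (mem_invariants_quotientRep N _ _ _).2 fun g => by
      rw [he, (mem_invariants_quotientRep N _ _ _).1 z.2]⟩
    invFun := fun w => ⟨e.symm w.1, (mem_invariants_quotientRep N _ _ _).2 fun g => by
      rw [← e.injective.eq_iff, ← he, e.apply_symm_apply,
        (mem_invariants_quotientRep N _ _ _).1 w.2]⟩
    left_inv := fun z => Subtype.ext (e.symm_apply_apply z.1)
    right_inv := fun w => Subtype.ext (e.apply_symm_apply w.1)
    map_add' := fun x y => Subtype.ext (map_add e x.1 y.1) }

end Conj

section FunRep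

/-- A coinduced module has trivial Tate cohomology as a module over a subgroup. -/
lemma isZero_tateCohomology_res_funRep (H : Subgroup G) [Fintype H] (V : Type u) [AddCommGroup V]
    [Module R V] (n : ℤ) :
    Limits.IsZero (tateCohomology (Rep.res H.subtype (funRep R G V)) n) := by
  classical
  have : Subsingleton (tateCohomology (Rep.res H.subtype (funRep R G V)) n) :=
      subsingleton_of_forall_eq 0 fun z => by
    rw [← one_nsmul z]
    -- The map φ keeps only the values at the chosen representatives of left cosets. For each x
    -- exactly one h in H, namely `h₀`, makes x h⁻¹ a representative, so the trace of φ is the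
    -- identity.
    refine nsmul_tateCohomology_eq_zero_of_trace
      (LinearMap.pi fun x : G => if x = (x : G ⧸ H).out then LinearMap.proj x else 0 :
        (G → V) →ₗ[R] (G → V))
      (fun (f : G → V) => ?_) n z
    funext x
    refine Eq.trans ?_ (Finset.sum_apply (M := fun _ : G => V) x _ _).symm
    let h₀ : H := ⟨(x : G ⧸ H).out⁻¹ * x, by
      rw [← QuotientGroup.eq]; simp⟩
    have hq (h : H) : ((x * (h : G)⁻¹ : G) : G ⧸ H) = x := by
      rw [QuotientGroup.eq]; simp
    have hh (h : H) : (x * (h : G)⁻¹ = ((x * (h : G)⁻¹ : G) : G ⧸ H).out) ↔ h = h₀ := by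
      rw [hq, mul_inv_eq_iff_eq_mul, ← inv_mul_eq_iff_eq_mul, eq_comm, Subtype.ext_iff]
    have hf (h : H) : (if h = h₀ then f x else 0) =
        (if x * (h : G)⁻¹ = ((x * (h : G)⁻¹ : G) : G ⧸ H).out
          then LinearMap.proj (R := R) (φ := fun _ : G => V) (x * (h : G)⁻¹) else 0)
          (fun y => f (y * h)) := by
      by_cases e : h = h₀
      · rw [if_pos e, if_pos ((hh h).2 e)]
        simp
      · rw [if_neg e, if_neg (mt (hh h).1 e)]
        rfl
    refine Eq.trans ?_ (Finset.sum_congr rfl fun h _ => hf h)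
    rw [Finset.sum_ite_eq', if_pos (Finset.mem_univ _)]
    exact congrFun (one_nsmul f) x
  exact ModuleCat.isZero_of_subsingleton _

end FunRep

section DegreeZero

variable [Fintype G] [Fintype (G ⧸ N)]

omit [N.Normal] in
lemma norm_eq_sum_quotient (M : Rep.{u} R G) (y : M.V) :
    M.ρ.norm y = ∑ q : G ⧸ N, M.ρ q.out ((Rep.res N.subtype M).ρ.norm y) := by
  simp only [Representation.norm, LinearMap.sum_apply, map_sum]
  rw [sum_eq_sum_quotient N]
  simp

omit [N.Normal] in
-- Inversion in G turns left cosets into right cosets, which moves the norm of N to the outside.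
-- This form makes restriction well defined on Ĥ⁰; `norm_eq_sum_quotient` bounds its kernel.
lemma norm_eq_norm_sum_quotient (M : Rep.{u} R G) (y : M.V) :
    M.ρ.norm y = (Rep.res N.subtype M).ρ.norm (∑ q : G ⧸ N, M.ρ q.out⁻¹ y) := by
  simp only [Representation.norm, LinearMap.sum_apply, map_sum]
  rw [← Equiv.sum_comp (Equiv.inv G), sum_eq_sum_quotient N]
  refine Finset.sum_congr rfl fun q _ => ?_
  rw [← Equiv.sum_comp (Equiv.inv N)]
  simp

lemma nonempty_natTorsion_conj_zero (hcop : (Nat.card N).Coprime (Nat.card (G ⧸ N)))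
    (M : Rep.{u} R G) :
    Nonempty (natTorsion (tateCohomology M 0) (Nat.card N) ≃+ (quotientRep N M 0).invariants) := by
  let B := Rep.res N.subtype M
  let ι : M.ρ.invariants →+ B.ρ.invariants :=
    M.ρ.invariants.toAddSubgroup.subtype.codRestrict B.ρ.invariants fun x h => x.2 (h : G)
  have hconj (g : G) (x y : B.ρ.invariants) (h : M.ρ g x.1 = y.1) :
      conjRep N M 0 g ((zeroClass B).hom x) = (zeroClass B).hom y :=
    homologyMap_complexMap_zeroClass _ _ _ x y h
  let r : M.ρ.invariants →+ (quotientRep N M 0).invariants :=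
    ((zeroClass B).hom.toAddMonoidHom.comp ι).codRestrict (quotientRep N M 0).invariants fun x =>
      (mem_invariants_quotientRep N M 0 _).2 fun g => hconj g (ι x) (ι x) (x.2 g)
  obtain ⟨f, hf⟩ := exists_zeroClass_lift M r fun x y hy => Subtype.ext
    ((zeroClass_eq_zero_iff B (ι x)).2 ⟨_, (norm_eq_norm_sum_quotient N M y).symm.trans hy⟩)
  -- The roles are exchanged here: kernel and cokernel of restriction are killed by #F. If a
  -- G-invariant x is the N-norm of y, then #F • x = ∑ q, q x is the G-norm of y.
  refine (nonempty_natTorsion_equiv hcop.symm f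
    (fun z => by rw [mul_comm]; exact card_mul_card_nsmul_tateCohomology N _ 0 z)
    (fun z hz => ?_) (fun z => ?_)).map
    fun e => e.trans (natTorsionEquiv fun z => Subtype.ext (card_nsmul_tateCohomology B 0 z.1))
  · obtain ⟨x, rfl⟩ := zeroClass_surjective M z
    rw [hf] at hz
    obtain ⟨y, hy⟩ := (zeroClass_eq_zero_iff B (ι x)).1 (congrArg Subtype.val hz)
    refine (map_nsmul (zeroClass M).hom _ x).symm.trans ((zeroClass_eq_zero_iff M _).2 ⟨y, ?_⟩)
    rw [norm_eq_sum_quotient N]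
    refine (Finset.sum_congr rfl fun q _ => (congrArg (M.ρ (Quotient.out q)) hy).trans
      (x.2 _)).trans ?_
    rw [Finset.sum_const, Finset.card_univ, ← Nat.card_eq_fintype_card]
    rfl
  · obtain ⟨x, hx⟩ := zeroClass_surjective B z.1
    have hmem (g : G) : M.ρ g x.1 ∈ B.ρ.invariants := fun h => by
      have h1 : M.ρ (g⁻¹ * h * g) x.1 = x.1 := by
        have h2 : M.ρ (g⁻¹ * h * g⁻¹⁻¹) x.1 = x.1 := x.2 (MulAut.conjNormal g⁻¹ h)
        rwa [inv_inv] at h2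
      change M.ρ (h : G) (M.ρ g x.1) = M.ρ g x.1
      conv_rhs => rw [← h1]
      simp [← Module.End.mul_apply, ← map_mul, mul_assoc]
    have hout (g : G) : M.ρ (g : G ⧸ N).out x.1 = M.ρ g x.1 := by
      have h1 : M.ρ (g⁻¹ * (g : G ⧸ N).out) x.1 = x.1 :=
        x.2 ⟨_, QuotientGroup.eq.1 (QuotientGroup.out_eq' _).symm⟩
      conv_rhs => rw [← h1]
      simp [← Module.End.mul_apply, ← map_mul]
    -- This sum is the transfer of x. As z is F-invariant, each translate of x again represents z,
    -- so the transfer restricts to #F • z.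
    have hsum : ∑ q : G ⧸ N, M.ρ q.out x.1 ∈ M.ρ.invariants := fun g => by
      rw [map_sum]
      conv_rhs => rw [← Equiv.sum_comp (Equiv.mulLeft (g : G ⧸ N))]
      refine Finset.sum_congr rfl fun q _ => ?_
      obtain ⟨k, rfl⟩ := QuotientGroup.mk_surjective q
      refine (congrArg (M.ρ g) (hout k)).trans (Eq.trans ?_ (hout (g * k)).symm)
      rw [map_mul]
      rfl
    refine ⟨(zeroClass M).hom ⟨_, hsum⟩, Subtype.ext ?_⟩
    rw [hf]
    change (zeroClass B).hom (ι ⟨_, hsum⟩) = Nat.card (G ⧸ N) • z.1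
    have : ι ⟨_, hsum⟩ = ∑ q : G ⧸ N, ⟨M.ρ q.out x.1, hmem q.out⟩ := by
      refine Subtype.ext (Eq.trans ?_ (AddSubmonoidClass.coe_finsetSum _ _).symm)
      rfl
    have hz (q : G ⧸ N) : (zeroClass B).hom ⟨M.ρ q.out x.1, hmem q.out⟩ = z.1 := by
      rw [← hconj q.out x _ rfl, hx]
      exact (mem_invariants_quotientRep N M 0 z.1).1 z.2 _
    rw [this, map_sum, Finset.sum_congr rfl fun q _ => hz q, Finset.sum_const, Finset.card_univ,
      ← Nat.card_eq_fintype_card]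

/-- If the order of `N` is coprime to its index, restriction identifies the invariants of the
cohomology of `N` with the part of the cohomology of `G` that is killed by the order of `N`. -/
lemma nonempty_natTorsion_conj (hcop : (Nat.card N).Coprime (Nat.card (G ⧸ N))) (n : ℤ) :
    ∀ M : Rep.{u} R G,
    Nonempty (natTorsion (tateCohomology M n) (Nat.card N) ≃+ (quotientRep N M n).invariants) := by
  refine dimensionShift (P := fun n (M : Rep.{u} R G) =>
    Nonempty (natTorsion (tateCohomology M n) (Nat.card N) ≃+ (quotientRep N M n).invariants))
    (nonempty_natTorsion_conj_zero N hcop) (fun n M ⟨e⟩ => ?_) (fun n M ⟨e⟩ => ?_) n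
  · let e₁ := δAddEquiv (coindSequence_shortExact M) n (isZero_tateCohomology_funRep R G M.V)
    let e₂ := invariantsδAddEquiv N (coindSequence_shortExact M) n
      (isZero_tateCohomology_res_funRep N M.V)
    exact ⟨(natTorsionCongr e₁ _).symm.trans (e.trans e₂)⟩
  · let e₁ := δAddEquiv (indSequence_shortExact M) n (isZero_tateCohomology_funRep R G M.V)
    let e₂ := invariantsδAddEquiv N (indSequence_shortExact M) n
      (isZero_tateCohomology_res_funRep N M.V)
    exact ⟨(natTorsionCongr e₁ _).trans (e.trans e₂.symm)⟩

end DegreeZero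

end TateConj

end

/-- `Ĥⁿ(G, M) ≅ Ĥⁿ(N, M)^F ⊕ Ĥⁿ(F, M^N)` for all integers `n`, where `F = G ⧸ N`. -/
theorem proposition3p3 {G : Type} [Group G] [Fintype G] (N : Subgroup G) [N.Normal]
    [Fintype N] [Fintype (G ⧸ N)] (hcop : (Nat.card N).Coprime (Nat.card (G ⧸ N)))
    (M : Rep.{0} ℤ G) (n : ℤ) :
    Nonempty (tateCohomology M n ≃+
      (TateConj.quotientRep N M n).invariants × tateCohomology (M.quotientToInvariants N) n) := by
  obtain ⟨e⟩ := nonempty_equiv_natTorsion_prod hcop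
    (TateConj.card_mul_card_nsmul_tateCohomology N M n)
  obtain ⟨e₁⟩ := TateConj.nonempty_natTorsion_conj N hcop n M
  obtain ⟨e₂⟩ := TateConj.nonempty_natTorsion_invariants N hcop M n
  obtain ⟨e₃⟩ := TateConj.nonempty_natTorsion_res N hcop n (M.quotientToInvariants N)
  exact ⟨e.trans (e₁.prodCongr (e₂.trans e₃))⟩
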